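/- Let $(\mathcal M,\mathbf g)$ be a smooth 4-dimensional Lorentzian manifold of signature $(-,+,+,+)$ with Levi-Civita connection $\mathbf D$, and let $\mathcal H\subset\mathcal M$ be a smooth null hypersurface (possibly with boundary) with null normal $L$ tangent to $\mathcal H$, $\mathbf D_LL=0$. Let $s$ be the affine parameter, i.e. $s$ is a smooth function on $\mathcal H$ with $Ls=1$ and $s=1$ on a spacelike surface $S=\{s=1\}$ (for instance a 2-sphere); assume that $\mathcal H$ emanates from $S$, i.e. $s\ge 1$ and each point of $\mathcal H$ is joined to $S$ by an integral curve of $L$. The level sets $S'_s$ of $s$ form the geodesic foliation. Let $v$ be a smooth function on $\mathcal H$ with $v=1$ on $S$ and $\Omega:=Lv>0$, with level sets $S_v$ (for instance the canonical foliation). For the foliation $(S_v)$ let $\underline L$ be the null vector field along $\mathcal H$ orthogonal to the leaves with $\mathbf g(L,\underline L)=-2$. For $X,Y$ tangent to the leaves put $$\chi(X,Y)=\mathbf g(\mathbf D_XL,Y),\quad \underline\chi(X,Y)=\mathbf g(\mathbf D_X\underline L,Y),\quad \zeta(X)=\tfrac12\mathbf g(\mathbf D_XL,\underline L),\quad \underline\eta(X)=\tfrac12\mathbf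 g(\mathbf D_L\underline L,X).$$ Let $\nabla$ be the induced covariant derivative on the leaves $S_v$, and let $\nabla_L$ be the projection of $\mathbf D_L$ onto the leaves. Denote by a prime the same objects for the geodesic foliation $(S'_s)$. Let $(e_1,e_2)$ and $(e'_1,e'_2)$ be smooth orthonormal frames tangent to the leaves of $(S_v)$ and of $(S'_s)$ respectively, with $\nabla_Le_A=0$ and $\nabla'_Le'_A=0$ (Fermi propagated) and with $e'_A=e_A$ on $S$; they are defined on an open subset of $\mathcal H$ which contains, with each point, the generator from $S$ to that point. For an $S'_s$-tangent tensor $\phi'$ let $\phi'^\dagger$ be the $S_v$-tangent tensor with $\phi'^\dagger(e_{A_1},\dots,e_{A_r})=\phi'(e'_{A_1},\dots,e'_{A_r})$. Let $\Upsilon:=\nabla s$, the $S_v$-tangent 1-form $X\mapsto X(s)$. Then, with indices referring to $(e_1,e_2)$ and repeated indices summed, $$\chi_{AB}=\chi'^\dagger_{AB},\qquad \zeta_A=\zeta'^\dagger_A+\chi'^\dagger_{AB}\Upsilon_B,\qquad \underline\eta_A=\underline\eta'^\dagger_A+\nabla_L\Upsilon_A,$$ $$\underline\chi_{AB}=\underline\chi'^\dagger_{AB}+2\Upsilon_A\underline\eta'^\dagger_B-2\zeta'^\dagger_A\Upsilon_B+2\nabla_A\Upsilon_B-|\Upsilon|^2\chi'^\dagger_{AB}.$$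 -/

import Mathlib

open scoped Manifold ContDiff

noncomputable section

namespace NullGeometry

/-- A smooth Lorentzian metric, of signature `(-,+,+,+)`, on a 4-manifold. -/
structure LorentzMetric (M : Type*) [TopologicalSpace M]
    [ChartedSpace (EuclideanSpace ℝ (Fin 4)) M] [IsManifold (𝓡 4) ∞ M] where
  /-- The bilinear form on each tangent space. -/
  form : ∀ x : M, TangentSpace (𝓡 4) x →L[ℝ] TangentSpace (𝓡 4) x →L[ℝ] ℝ
  symm : ∀ (x : M) (u w : TangentSpace (𝓡 4) x), form x u w = form x w u
  signature : ∀ x : M, ∃ b : Module.Basis (Fin 4) ℝ (TangentSpace (𝓡 4) x),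
    ∀ i j, form x (b i) (b j) = if i = j then (if i = 0 then -1 else 1) else 0
  smooth : ContMDiff (𝓡 4)
    ((𝓡 4).prod 𝓘(ℝ, EuclideanSpace ℝ (Fin 4) →L[ℝ] EuclideanSpace ℝ (Fin 4) →L[ℝ] ℝ)) ∞
    (fun x ↦ Bundle.TotalSpace.mk'
      (EuclideanSpace ℝ (Fin 4) →L[ℝ] EuclideanSpace ℝ (Fin 4) →L[ℝ] ℝ)
      (E := fun x : M ↦ TangentSpace (𝓡 4) x →L[ℝ] TangentSpace (𝓡 4) x →L[ℝ] ℝ) x (form x))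

section Connection

variable {M : Type*} [TopologicalSpace M] [ChartedSpace (EuclideanSpace ℝ (Fin 4)) M]
  [IsManifold (𝓡 4) ∞ M]

/-- The coordinate vector field `∂_i` of the preferred chart at `x₀`, evaluated at `x`. -/
def coordField (x₀ : M) (i : Fin 4) (x : M) : TangentSpace (𝓡 4) x :=
  (trivializationAt (EuclideanSpace ℝ (Fin 4)) (TangentSpace (𝓡 4)) x₀).symmL ℝ x
    (EuclideanSpace.single i (1 : ℝ))

/-- The metric component `g_ij` in the preferred chart at `x₀`, as a function near `x₀`. -/
def LorentzMetric.component (g : LorentzMetric M) (x₀ : M) (i j : Fin 4) (x : M) : ℝ :=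
  g.form x (coordField x₀ i x) (coordField x₀ j x)

/-- The coordinate derivative `∂_k g_ij` at `x₀`, in the preferred chart at `x₀`. -/
def LorentzMetric.dComponent (g : LorentzMetric M) (x₀ : M) (k i j : Fin 4) : ℝ :=
  mfderiv (𝓡 4) 𝓘(ℝ, ℝ) (g.component x₀ i j) x₀ (coordField x₀ k x₀)

/-- The Christoffel symbol `Γ^k_ij = ½ g^{kl} (∂_i g_jl + ∂_j g_il - ∂_l g_ij)` at `x₀`, in the
preferred chart at `x₀`. -/
def LorentzMetric.christoffel (g : LorentzMetric M) (x₀ : M) (k i j : Fin 4) : ℝ :=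
  (1 / 2) * ∑ l, (Matrix.of fun a b ↦ g.component x₀ a b x₀)⁻¹ k l *
    (g.dComponent x₀ i j l + g.dComponent x₀ j i l - g.dComponent x₀ l i j)

/-- The `i`-th coordinate of a tangent vector at `x` with respect to the preferred chart at `x`. -/
def coord {x : M} (u : TangentSpace (𝓡 4) x) (i : Fin 4) : ℝ :=
  (EuclideanSpace.proj i : EuclideanSpace ℝ (Fin 4) →L[ℝ] ℝ) u

/-- The vector `Γ^k_ij u^i w^j ∂_k` at `x`. -/
def LorentzMetric.christoffelMap (g : LorentzMetric M) (x : M) (u w : TangentSpace (𝓡 4) x) :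
    TangentSpace (𝓡 4) x :=
  ∑ k, (∑ i, ∑ j, g.christoffel x k i j * coord u i * coord w j) • coordField x k x

variable {H : Type*} [TopologicalSpace H] [ChartedSpace (EuclideanHalfSpace 3) H]
  [IsManifold (𝓡∂ 3) ∞ H]

/-- The vector `X(V^k) ∂_k` at `F p`, where `V^k` are the components, in the preferred chart of `M`
at `F p`, of a vector field `V` along a map `F : H → M`. -/
def componentDeriv (F : H → M) (V : ∀ q : H, TangentSpace (𝓡 4) (F q)) (p : H)
    (X : TangentSpace (𝓡∂ 3) p) : TangentSpace (𝓡 4) (F p) :=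
  mfderiv (𝓡∂ 3) 𝓘(ℝ, EuclideanSpace ℝ (Fin 4))
    (fun q ↦ (trivializationAt (EuclideanSpace ℝ (Fin 4)) (TangentSpace (𝓡 4)) (F p)
      (⟨F q, V q⟩ : TangentBundle (𝓡 4) M)).2) p X

/-- The Levi-Civita covariant derivative `D_X V = (X(V^k) + Γ^k_ij (dF X)^i V^j) ∂_k` at `p` of a
vector field `V` along a map `F : H → M` in the direction `X ∈ T_p H`. -/
def covDeriv (g : LorentzMetric M) (F : H → M) (V : ∀ q : H, TangentSpace (𝓡 4) (F q)) (p : H)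
    (X : TangentSpace (𝓡∂ 3) p) : TangentSpace (𝓡 4) (F p) :=
  componentDeriv F V p X + g.christoffelMap (F p) (mfderiv (𝓡∂ 3) (𝓡 4) F p X) (V p)

/-- The derivative `X f` of a function `f` on `H`. -/
def dirDeriv (f : H → ℝ) (p : H) (X : TangentSpace (𝓡∂ 3) p) : ℝ :=
  mfderiv (𝓡∂ 3) 𝓘(ℝ, ℝ) f p X

/-- `X` is tangent to the leaf through `p` of the foliation by the level sets of `v`. -/
def IsLeafTangent (v : H → ℝ) {p : H} (X : TangentSpace (𝓡∂ 3) p) : Prop :=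
  dirDeriv v p X = 0

end Connection

/-- A null hypersurface `H` of `(M, g)` emanating from `S = {s = 1}`, together with its null
geodesic generator `L` and the affine parameter `s`. The hypersurface is a 3-manifold, possibly
with boundary, immersed in `M`; it is null because its normal `L` is tangent to it. -/
structure NullHypersurface {M : Type*} [TopologicalSpace M]
    [ChartedSpace (EuclideanSpace ℝ (Fin 4)) M] [IsManifold (𝓡 4) ∞ M] (g : LorentzMetric M)
    (H : Type*) [TopologicalSpace H] [ChartedSpace (EuclideanHalfSpace 3) H]
    [IsManifold (𝓡∂ 3) ∞ H] where
  /-- The immersion of the hypersurface. -/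
  incl : H → M
  incl_smooth : ContMDiff (𝓡∂ 3) (𝓡 4) ∞ incl
  incl_immersion : ∀ p, Function.Injective (mfderiv (𝓡∂ 3) (𝓡 4) incl p)
  /-- The null generator. -/
  L : ∀ p : H, TangentSpace (𝓡∂ 3) p
  L_smooth : ContMDiff (𝓡∂ 3) (𝓡∂ 3).tangent ∞ (fun p ↦ (⟨p, L p⟩ : TangentBundle (𝓡∂ 3) H))
  L_normal : ∀ (p : H) (X : TangentSpace (𝓡∂ 3) p),
    g.form (incl p) (mfderiv (𝓡∂ 3) (𝓡 4) incl p (L p)) (mfderiv (𝓡∂ 3) (𝓡 4) incl p X) = 0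
  L_geodesic : ∀ p : H,
    covDeriv g incl (fun q ↦ mfderiv (𝓡∂ 3) (𝓡 4) incl q (L q)) p (L p) = 0
  /-- The affine parameter. -/
  s : H → ℝ
  s_smooth : ContMDiff (𝓡∂ 3) 𝓘(ℝ, ℝ) ∞ s
  L_s : ∀ p : H, mfderiv (𝓡∂ 3) 𝓘(ℝ, ℝ) s p (L p) = (1 : ℝ)
  one_le_s : ∀ p : H, 1 ≤ s p
  /-- Every point is reached from `S = {s = 1}` along an integral curve of `L`. -/
  emanates : ∀ p : H, ∃ γ : ℝ → H, s (γ 1) = 1 ∧ γ (s p) = p ∧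
    IsMIntegralCurveOn (I := 𝓡∂ 3) γ L (Set.Icc 1 (s p))

namespace NullHypersurface

variable {M : Type*} [TopologicalSpace M] [ChartedSpace (EuclideanSpace ℝ (Fin 4)) M]
  [IsManifold (𝓡 4) ∞ M] {g : LorentzMetric M}
  {H : Type*} [TopologicalSpace H] [ChartedSpace (EuclideanHalfSpace 3) H]
  [IsManifold (𝓡∂ 3) ∞ H] (N : NullHypersurface g H)

/-- A vector tangent to `H`, seen as a vector of the ambient space. -/
def push {p : H} (X : TangentSpace (𝓡∂ 3) p) : TangentSpace (𝓡 4) (N.incl p) :=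
  mfderiv (𝓡∂ 3) (𝓡 4) N.incl p X

/-- `g(u, w)` for ambient vectors at a point of `H`. -/
def inner (p : H) (u w : TangentSpace (𝓡 4) (N.incl p)) : ℝ := g.form (N.incl p) u w

/-- `D_X V` for a vector field `V` of `M` along `H` and `X` tangent to `H`. -/
def D (V : ∀ q : H, TangentSpace (𝓡 4) (N.incl q)) (p : H) (X : TangentSpace (𝓡∂ 3) p) :
    TangentSpace (𝓡 4) (N.incl p) :=
  covDeriv g N.incl V p X

/-- `v` is a foliation function on `H`: its level sets are the leaves `S_v`, its null lapse
`Ω = L v` is positive, and `v = 1` on `S = {s = 1}`. -/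
structure IsFoliation (v : H → ℝ) : Prop where
  smooth : ContMDiff (𝓡∂ 3) 𝓘(ℝ, ℝ) ∞ v
  lapse_pos : ∀ p : H, 0 < dirDeriv v p (N.L p)
  initial : ∀ p : H, N.s p = 1 → v p = 1

/-- The orthogonal projection of an ambient vector onto the tangent space of the leaf, of which
`(e_1, e_2)` is an orthonormal basis. -/
def proj (e : Fin 2 → ∀ p : H, TangentSpace (𝓡∂ 3) p) (p : H)
    (w : TangentSpace (𝓡 4) (N.incl p)) : TangentSpace (𝓡∂ 3) p :=
  ∑ A, N.inner p w (N.push (e A p)) • e A p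

/-- The induced derivative of a leaf-tangent vector field `Y`: the projection of `D_X Y` onto the
tangent space of the leaf. -/
def slashD (e : Fin 2 → ∀ p : H, TangentSpace (𝓡∂ 3) p)
    (Y : ∀ p : H, TangentSpace (𝓡∂ 3) p) (p : H) (X : TangentSpace (𝓡∂ 3) p) :
    TangentSpace (𝓡∂ 3) p :=
  N.proj e p (N.D (fun q ↦ N.push (Y q)) p X)

/-- The induced derivative `(∇̸_X θ)(Y)` of a leaf-tangent 1-form `θ`: it is linear in the
leaf-tangent vector `Y` and `(∇̸_X θ)(e_B) = X(θ(e_B)) - θ(∇̸_X e_B)`. Both `X` tangent to the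
leaf and `X = L` are used. -/
def slashDForm (e : Fin 2 → ∀ p : H, TangentSpace (𝓡∂ 3) p)
    (θ : ∀ p : H, TangentSpace (𝓡∂ 3) p → ℝ) (p : H) (X Y : TangentSpace (𝓡∂ 3) p) : ℝ :=
  ∑ B, N.inner p (N.push Y) (N.push (e B p)) *
    (dirDeriv (fun q ↦ θ q (e B q)) p X - θ p (N.slashD e (e B) p X))

/-- `(L, Lbar, e_1, e_2)` is, on the open set `U`, a smooth Fermi propagated orthonormal null frame
for the foliation by the level sets of `v`. -/
structure IsFermiNullFrame (v : H → ℝ) (Lbar : ∀ p : H, TangentSpace (𝓡 4) (N.incl p))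
    (e : Fin 2 → ∀ p : H, TangentSpace (𝓡∂ 3) p) (U : Set H) : Prop where
  Lbar_smooth : ContMDiffOn (𝓡∂ 3) (𝓡 4).tangent ∞
    (fun p ↦ (⟨N.incl p, Lbar p⟩ : TangentBundle (𝓡 4) M)) U
  Lbar_null : ∀ p ∈ U, N.inner p (Lbar p) (Lbar p) = 0
  Lbar_L : ∀ p ∈ U, N.inner p (Lbar p) (N.push (N.L p)) = -2
  Lbar_orthogonal : ∀ p ∈ U, ∀ X : TangentSpace (𝓡∂ 3) p, IsLeafTangent v X →
    N.inner p (Lbar p) (N.push X) = 0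
  e_smooth : ∀ A, ContMDiffOn (𝓡∂ 3) (𝓡∂ 3).tangent ∞
    (fun p ↦ (⟨p, e A p⟩ : TangentBundle (𝓡∂ 3) H)) U
  e_tangent : ∀ A, ∀ p ∈ U, IsLeafTangent v (e A p)
  e_orthonormal : ∀ A B, ∀ p ∈ U,
    N.inner p (N.push (e A p)) (N.push (e B p)) = if A = B then 1 else 0
  fermi : ∀ A, ∀ p ∈ U, N.slashD e (e A) p (N.L p) = 0

/-- `U` contains, with each of its points, the generators of `H` from `S` to that point. -/
def IsGeneratorSaturated (U : Set H) : Prop :=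
  ∀ (γ : ℝ → H) (a : ℝ), 1 ≤ a → N.s (γ 1) = 1 →
    IsMIntegralCurveOn (I := 𝓡∂ 3) γ N.L (Set.Icc 1 a) → γ a ∈ U → ∀ t ∈ Set.Icc 1 a, γ t ∈ U

/-! The null connection coefficients, to be evaluated on vectors tangent to the leaves. The
foliation enters through `Lbar` and through the vectors on which they are evaluated. -/

/-- `χ(X, Y) = g(D_X L, Y)`. -/
def chi (p : H) (X Y : TangentSpace (𝓡∂ 3) p) : ℝ :=
  N.inner p (N.D (fun q ↦ N.push (N.L q)) p X) (N.push Y)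

/-- `χbar(X, Y) = g(D_X Lbar, Y)`. -/
def chibar (Lbar : ∀ p : H, TangentSpace (𝓡 4) (N.incl p)) (p : H)
    (X Y : TangentSpace (𝓡∂ 3) p) : ℝ :=
  N.inner p (N.D Lbar p X) (N.push Y)

/-- `ζ(X) = ½ g(D_X L, Lbar)`. -/
def zeta (Lbar : ∀ p : H, TangentSpace (𝓡 4) (N.incl p)) (p : H)
    (X : TangentSpace (𝓡∂ 3) p) : ℝ :=
  (1 / 2) * N.inner p (N.D (fun q ↦ N.push (N.L q)) p X) (Lbar p)

/-- `ηbar(X) = ½ g(D_L Lbar, X)`. -/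
def etabar (Lbar : ∀ p : H, TangentSpace (𝓡 4) (N.incl p)) (p : H)
    (X : TangentSpace (𝓡∂ 3) p) : ℝ :=
  (1 / 2) * N.inner p (N.D Lbar p (N.L p)) (N.push X)

/-- The 1-form `Υ = ∇̸ s` on the leaves: the derivative of `s` along leaf-tangent vectors. -/
def Upsilon (p : H) (X : TangentSpace (𝓡∂ 3) p) : ℝ := dirDeriv N.s p X

/-- `|Υ|²`. -/
def UpsilonSq (e : Fin 2 → ∀ p : H, TangentSpace (𝓡∂ 3) p) (p : H) : ℝ :=
  ∑ A, N.Upsilon p (e A p) ^ 2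

/-- The projection `φ^†` of a 1-tensor: the 1-tensor tangent to the leaves framed by `e` with
`φ^†(e_A) = φ(e'_A)`. -/
def dagger₁ (e e' : Fin 2 → ∀ p : H, TangentSpace (𝓡∂ 3) p)
    (φ : ∀ p : H, TangentSpace (𝓡∂ 3) p → ℝ) (p : H) (X : TangentSpace (𝓡∂ 3) p) : ℝ :=
  ∑ A, N.inner p (N.push X) (N.push (e A p)) * φ p (e' A p)

/-- The projection `φ^†` of a 2-tensor: the 2-tensor tangent to the leaves framed by `e` with
`φ^†(e_A, e_B) = φ(e'_A, e'_B)`. -/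
def dagger₂ (e e' : Fin 2 → ∀ p : H, TangentSpace (𝓡∂ 3) p)
    (φ : ∀ p : H, TangentSpace (𝓡∂ 3) p → TangentSpace (𝓡∂ 3) p → ℝ) (p : H)
    (X Y : TangentSpace (𝓡∂ 3) p) : ℝ :=
  ∑ A, ∑ B, N.inner p (N.push X) (N.push (e A p)) * N.inner p (N.push Y) (N.push (e B p)) *
    φ p (e' A p) (e' B p)

end NullHypersurface

end NullGeometry

end

/-
Both null frames have the same generator `L`, so they differ by a null rotation. Fermi propagation
makes `g(e_A, e'_B)` constant along the generators, hence equal to `δ_AB` everywhere, which forces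
`e_A = e'_A + Υ_A L` and `Lbar = Lbar' + 2 Υ_A e_A - |Υ|² L`. On arbitrary vectors tangent to the
hypersurface, `χ` annihilates `L` in both slots, `ζ'` and `ηbar'` annihilate `L`, and `χbar'` takes
the values `χbar'(X, L) = -2 ζ'(X)` and `χbar'(L, Y) = 2 ηbar'(Y)`; this evaluates the projections
`φ^†`. Differentiating `g(Lbar, e_B) = 0` and `g(Lbar', e_B) = -2 Υ_B` gives one identity for
`g(D_X Lbar, Y)`, of which the transformation laws of `χbar` and `ηbar` are the cases of `Y` tangent
to the leaf and of `X = L`.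
-/

noncomputable section

namespace NullGeometry

section Metric

variable {M : Type*} [TopologicalSpace M] [ChartedSpace (EuclideanSpace ℝ (Fin 4)) M]

/-- The coordinate vectors `∂_i` at `x` of the preferred chart at `x`, as a basis. -/
def coordBasis (x : M) : Module.Basis (Fin 4) ℝ (TangentSpace (𝓡 4) x) :=
  (EuclideanSpace.basisFun (Fin 4) ℝ).toBasis

theorem coordBasis_repr {x : M} (u : TangentSpace (𝓡 4) x) (i : Fin 4) :
    (coordBasis x).repr u i = coord u i :=
  rfl

variable [IsManifold (𝓡 4) ∞ M]

/-- The trivialization of the tangent bundle given by the preferred chart at `x₀`. -/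
abbrev tangentTriv (x₀ : M) := trivializationAt (EuclideanSpace ℝ (Fin 4)) (TangentSpace (𝓡 4)) x₀

theorem tangentTriv_symmL_self (x : M) (a : EuclideanSpace ℝ (Fin 4)) :
    (tangentTriv x).symmL ℝ x a = a := by
  rw [TangentBundle.symmL_trivializationAt_eq_core (mem_chart_source _ x)]
  exact (tangentBundleCore (𝓡 4) M).coordChange_self (achart _ x) x (mem_chart_source _ x) a

theorem symmL_tangentTriv {x₀ x : M} (hx : x ∈ (tangentTriv x₀).baseSet)
    (u : TangentSpace (𝓡 4) x) :
    (tangentTriv x₀).symmL ℝ x (tangentTriv x₀ (⟨x, u⟩ : TangentBundle (𝓡 4) M)).2 = u :=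
  ((tangentTriv x₀).symmL_apply hx _).trans ((tangentTriv x₀).symm_apply_apply_mk hx u)

theorem tangentTriv_self (x : M) (u : TangentSpace (𝓡 4) x) :
    (tangentTriv x (⟨x, u⟩ : TangentBundle (𝓡 4) M)).2 = u :=
  (tangentTriv_symmL_self x _).symm.trans
    (symmL_tangentTriv (mem_baseSet_trivializationAt _ _ x) u)

theorem coordBasis_apply (x : M) (i : Fin 4) : coordBasis x i = coordField x i x := by
  rw [coordField, tangentTriv_symmL_self]
  exact (EuclideanSpace.basisFun (Fin 4) ℝ).coe_toBasis ▸ EuclideanSpace.basisFun_apply ..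

theorem sum_coord_smul_coordField {x : M} (u : TangentSpace (𝓡 4) x) :
    ∑ i, coord u i • coordField x i x = u := by
  simpa only [coordBasis_repr, coordBasis_apply] using (coordBasis x).sum_repr u

namespace LorentzMetric

variable (g : LorentzMetric M)

/-- The metric read in the preferred chart at `x₀`, as a function of the point `x` with values in
the bilinear forms on the model space. -/
def chartForm (x₀ x : M) : EuclideanSpace ℝ (Fin 4) →L[ℝ] EuclideanSpace ℝ (Fin 4) →L[ℝ] ℝ :=
  (trivializationAt (EuclideanSpace ℝ (Fin 4) →L[ℝ] EuclideanSpace ℝ (Fin 4) →L[ℝ] ℝ)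
    (fun x : M ↦ TangentSpace (𝓡 4) x →L[ℝ] TangentSpace (𝓡 4) x →L[ℝ] ℝ) x₀ ⟨x, g.form x⟩).2

theorem mdifferentiableAt_chartForm (x₀ : M) :
    MDifferentiableAt (𝓡 4) 𝓘(ℝ, EuclideanSpace ℝ (Fin 4) →L[ℝ] EuclideanSpace ℝ (Fin 4) →L[ℝ] ℝ)
      (g.chartForm x₀) x₀ :=
  ((Bundle.contMDiffAt_section _).1 (g.smooth x₀)).mdifferentiableAt (by simp)

variable {g} in
theorem chartForm_apply {x₀ x : M} (hx : x ∈ (tangentTriv x₀).baseSet)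
    (a b : EuclideanSpace ℝ (Fin 4)) :
    g.chartForm x₀ x a b =
      g.form x ((tangentTriv x₀).symmL ℝ x a) ((tangentTriv x₀).symmL ℝ x b) := by
  simp only [chartForm, hom_trivializationAt_apply]
  rw [inCoordinates_apply_eq₂ hx hx (Set.mem_univ _),
    (tangentTriv x₀).symmL_apply hx,
    (tangentTriv x₀).symmL_apply hx]
  simp

variable {g} in
theorem chartForm_tangentTriv {x₀ x : M} (hx : x ∈ (tangentTriv x₀).baseSet)
    (u w : TangentSpace (𝓡 4) x) :
    g.chartForm x₀ x (tangentTriv x₀ (⟨x, u⟩ : TangentBundle (𝓡 4) M)).2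
      (tangentTriv x₀ (⟨x, w⟩ : TangentBundle (𝓡 4) M)).2 = g.form x u w := by
  rw [chartForm_apply hx, symmL_tangentTriv hx, symmL_tangentTriv hx]

theorem chartForm_self (x : M) : g.chartForm x x = g.form x := by
  ext a b
  rw [chartForm_apply (mem_baseSet_trivializationAt _ _ x), tangentTriv_symmL_self,
    tangentTriv_symmL_self]
  rfl

/-- The derivative `u(g_ij) w^i z^j` at `x` of the metric components in the preferred chart
at `x`, as a trilinear form in `u`, `w`, `z`. -/
def formDeriv (x : M) : TangentSpace (𝓡 4) x →L[ℝ] TangentSpace (𝓡 4) x →L[ℝ]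
    TangentSpace (𝓡 4) x →L[ℝ] ℝ :=
  mfderiv (𝓡 4) 𝓘(ℝ, EuclideanSpace ℝ (Fin 4) →L[ℝ] EuclideanSpace ℝ (Fin 4) →L[ℝ] ℝ)
    (g.chartForm x) x

theorem formDeriv_apply (x : M) (u : TangentSpace (𝓡 4) x) (a b : EuclideanSpace ℝ (Fin 4)) :
    g.formDeriv x u a b = mfderiv (𝓡 4) 𝓘(ℝ, ℝ) (fun y ↦ g.chartForm x y a b) x u := by
  have h := ((ContinuousLinearMap.apply ℝ ℝ b).comp (ContinuousLinearMap.apply ℝ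
    (EuclideanSpace ℝ (Fin 4) →L[ℝ] ℝ) a)).hasMFDerivAt.comp x
      (g.mdifferentiableAt_chartForm x).hasMFDerivAt
  exact (DFunLike.congr_fun h.mfderiv u).symm

theorem formDeriv_comm (x : M) (u : TangentSpace (𝓡 4) x) (a b : EuclideanSpace ℝ (Fin 4)) :
    g.formDeriv x u a b = g.formDeriv x u b a := by
  have hsymm : (fun y ↦ g.chartForm x y a b) =ᶠ[nhds x] fun y ↦ g.chartForm x y b a := by
    filter_upwards [(tangentTriv x).open_baseSet.mem_nhds (mem_baseSet_trivializationAt _ _ x)]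
      with y hy
    rw [chartForm_apply hy, g.symm, chartForm_apply hy]
  exact (g.formDeriv_apply x u a b).trans
    ((DFunLike.congr_fun hsymm.mfderiv_eq u).trans (g.formDeriv_apply x u b a).symm)

theorem dComponent_eq_formDeriv (x : M) (k i j : Fin 4) :
    g.dComponent x k i j =
      g.formDeriv x (coordField x k x) (coordField x i x) (coordField x j x) := by
  have hcomp : g.component x i j =ᶠ[nhds x] fun y ↦
      g.chartForm x y (EuclideanSpace.single i 1) (EuclideanSpace.single j 1) := by
    filter_upwards [(tangentTriv x).open_baseSet.mem_nhds (mem_baseSet_trivializationAt _ _ x)]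
      with y hy using (chartForm_apply hy _ _).symm
  have hself (l : Fin 4) : coordField x l x = EuclideanSpace.single l (1 : ℝ) :=
    tangentTriv_symmL_self x _
  rw [dComponent, hcomp.mfderiv_eq, hself i, hself j, formDeriv_apply]
  rfl

theorem nondegenerate_form (x : M) : (g.form x).toBilinForm.Nondegenerate := by
  obtain ⟨b, hb⟩ := g.signature x
  have hdiag : LinearMap.BilinForm.toMatrix b (g.form x).toBilinForm =
      Matrix.diagonal fun i ↦ if i = 0 then -1 else 1 := by
    ext i j
    simpa [Matrix.diagonal_apply] using hb i j
  refine LinearMap.BilinForm.nondegenerate_of_det_ne_zero _ b ?_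
  simp [hdiag, Matrix.det_diagonal]

theorem isUnit_det_component (x : M) :
    IsUnit (Matrix.of fun i j ↦ g.component x i j x).det := by
  have hmatrix : Matrix.of (fun i j ↦ g.component x i j x) =
      LinearMap.BilinForm.toMatrix (coordBasis x) (g.form x).toBilinForm := by
    ext i j
    simp [component, coordBasis_apply]
  rw [hmatrix, isUnit_iff_ne_zero]
  exact (LinearMap.BilinForm.nondegenerate_iff_det_ne_zero _).1 (g.nondegenerate_form x)

theorem sum_component_mul_christoffel (x : M) (i j m : Fin 4) :
    ∑ k, g.component x m k x * g.christoffel x k i j =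
      (1 / 2) * (g.dComponent x i j m + g.dComponent x j i m - g.dComponent x m i j) := by
  set G := Matrix.of fun a b ↦ g.component x a b x
  set c : Fin 4 → ℝ := fun l ↦ g.dComponent x i j l + g.dComponent x j i l - g.dComponent x l i j
  calc ∑ k, g.component x m k x * g.christoffel x k i j
    _ = (G.mulVec ((1 / 2 : ℝ) • G⁻¹.mulVec c)) m := rfl
    _ = (1 / 2) * c m := by
      rw [Matrix.mulVec_smul, Matrix.mulVec_mulVec, G.mul_nonsing_inv (g.isUnit_det_component x),
        Matrix.one_mulVec, Pi.smul_apply, smul_eq_mul]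

theorem form_sum_christoffel (x : M) (i j : Fin 4) (z : TangentSpace (𝓡 4) x) :
    g.form x (∑ k, g.christoffel x k i j • coordField x k x) z =
      (1 / 2) * (g.formDeriv x (coordField x i x) (coordField x j x) z +
        g.formDeriv x (coordField x j x) (coordField x i x) z -
        g.formDeriv x z (coordField x i x) (coordField x j x)) := by
  set Γ := ∑ k, g.christoffel x k i j • coordField x k x with hΓ
  have hcoord (m : Fin 4) : g.form x Γ (coordField x m x) =
      (1 / 2) * (g.dComponent x i j m + g.dComponent x j i m - g.dComponent x m i j) := by
    rw [hΓ, ← sum_component_mul_christoffel, map_sum, sum_apply]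
    refine Finset.sum_congr rfl fun k _ ↦ ?_
    rw [map_smul, smul_apply, smul_eq_mul, mul_comm, g.symm, component]
  have hz := (sum_coord_smul_coordField z).symm
  -- Freezing the coordinates lets `z` be replaced by its expansion everywhere else.
  clear_value Γ
  generalize coord z = c at hz
  subst hz
  simp only [map_sum, map_smul, smul_eq_mul, hcoord, dComponent_eq_formDeriv, Finset.mul_sum,
    sum_apply, smul_apply, ← Finset.sum_add_distrib, ← Finset.sum_sub_distrib]
  exact Finset.sum_congr rfl fun m _ ↦ by ring

theorem koszul_formula (x : M) (u w z : TangentSpace (𝓡 4) x) :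
    g.form x (g.christoffelMap x u w) z =
      (1 / 2) * (g.formDeriv x u w z + g.formDeriv x w u z - g.formDeriv x z u w) := by
  have hexpand : g.christoffelMap x u w =
      ∑ i, ∑ j, (coord u i * coord w j) • ∑ k, g.christoffel x k i j • coordField x k x := by
    simp only [christoffelMap, Finset.sum_smul, Finset.smul_sum, smul_smul]
    rw [Finset.sum_comm]
    refine Finset.sum_congr rfl fun i _ ↦ ?_
    rw [Finset.sum_comm]
    refine Finset.sum_congr rfl fun j _ ↦ Finset.sum_congr rfl fun k _ ↦ ?_
    congr 1
    ring
  have hu := (sum_coord_smul_coordField u).symm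
  have hw := (sum_coord_smul_coordField w).symm
  rw [hexpand]
  generalize coord u = a at hu ⊢
  generalize coord w = b at hw ⊢
  subst hu hw
  simp only [map_sum, sum_apply]
  rw [Finset.sum_comm (f := fun j i ↦
      g.formDeriv x (a i • coordField x i x) (b j • coordField x j x) z),
    Finset.sum_comm (f := fun j i ↦
      g.formDeriv x z (a i • coordField x i x) (b j • coordField x j x))]
  simp only [map_smul, smul_apply, smul_eq_mul, form_sum_christoffel, Finset.mul_sum,
    ← Finset.sum_add_distrib, ← Finset.sum_sub_distrib]
  exact Finset.sum_congr rfl fun i _ ↦ Finset.sum_congr rfl fun j _ ↦ by ring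

theorem form_christoffelMap_add (x : M) (u w z : TangentSpace (𝓡 4) x) :
    g.form x (g.christoffelMap x u w) z + g.form x w (g.christoffelMap x u z) =
      g.formDeriv x u w z := by
  rw [g.symm x w, koszul_formula, koszul_formula, g.formDeriv_comm x u z w,
    g.formDeriv_comm x z u w, g.formDeriv_comm x w u z]
  ring

end LorentzMetric

end Metric

section Connection

theorem hasMFDerivAt_clm_apply {E K : Type*} [NormedAddCommGroup E] [NormedSpace ℝ E]
    [TopologicalSpace K] {I : ModelWithCorners ℝ E K} {P : Type*} [TopologicalSpace P]
    [ChartedSpace K P] {E₁ E₂ : Type*} [NormedAddCommGroup E₁] [NormedSpace ℝ E₁]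
    [NormedAddCommGroup E₂] [NormedSpace ℝ E₂] {G : P → E₁ →L[ℝ] E₂} {a : P → E₁} {p : P}
    {G' : E →L[ℝ] E₁ →L[ℝ] E₂} {a' : E →L[ℝ] E₁}
    (hG : HasMFDerivAt I 𝓘(ℝ, E₁ →L[ℝ] E₂) G p G') (ha : HasMFDerivAt I 𝓘(ℝ, E₁) a p a') :
    HasMFDerivAt I 𝓘(ℝ, E₂) (fun q ↦ G q (a q)) p ((G p).comp a' + G'.flip (a p)) :=
  ⟨hG.1.clm_apply ha.1, by
    simpa [writtenInExtChartAt, Function.comp_def] using! hG.2.clm_apply ha.2⟩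

section DirDeriv

variable {H : Type*} [TopologicalSpace H] [ChartedSpace (EuclideanHalfSpace 3) H]

theorem dirDeriv_congr {f₁ f₂ : H → ℝ} {p : H} (h : f₁ =ᶠ[nhds p] f₂)
    (X : TangentSpace (𝓡∂ 3) p) : dirDeriv f₁ p X = dirDeriv f₂ p X :=
  DFunLike.congr_fun h.mfderiv_eq X

theorem dirDeriv_const (c : ℝ) (p : H) (X : TangentSpace (𝓡∂ 3) p) :
    dirDeriv (fun _ ↦ c) p X = 0 :=
  DFunLike.congr_fun mfderiv_const X

theorem dirDeriv_add_right (f : H → ℝ) (p : H) (X Y : TangentSpace (𝓡∂ 3) p) :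
    dirDeriv f p (X + Y) = dirDeriv f p X + dirDeriv f p Y :=
  map_add _ X Y

theorem dirDeriv_smul_right (f : H → ℝ) (p : H) (c : ℝ) (X : TangentSpace (𝓡∂ 3) p) :
    dirDeriv f p (c • X) = c * dirDeriv f p X :=
  map_smul _ c X

theorem dirDeriv_const_mul (c : ℝ) {f : H → ℝ} {p : H}
    (hf : MDifferentiableAt (𝓡∂ 3) 𝓘(ℝ, ℝ) f p) (X : TangentSpace (𝓡∂ 3) p) :
    dirDeriv (fun q ↦ c * f q) p X = c * dirDeriv f p X :=
  DFunLike.congr_fun (hf.hasMFDerivAt.const_smul c).mfderiv X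

theorem eq_of_dirDeriv_eq_zero {V : ∀ p : H, TangentSpace (𝓡∂ 3) p} {f : H → ℝ} {γ : ℝ → H}
    {a b : ℝ} (hab : a ≤ b)
    (hγ : IsMIntegralCurveOn (I := 𝓡∂ 3) γ V (Set.Icc a b))
    (hf : ∀ t ∈ Set.Icc a b, MDifferentiableAt (𝓡∂ 3) 𝓘(ℝ, ℝ) f (γ t))
    (hf' : ∀ t ∈ Set.Icc a b, dirDeriv f (γ t) (V (γ t)) = 0) : f (γ b) = f (γ a) := by
  have hderiv (t : ℝ) (ht : t ∈ Set.Icc a b) :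
      HasDerivWithinAt (fun t ↦ f (γ t)) 0 (Set.Icc a b) t := by
    refine hasDerivWithinAt_iff_hasFDerivWithinAt.2 (HasFDerivWithinAt.congr_fderiv
      ((hf t ht).hasMFDerivAt.comp_hasMFDerivWithinAt t (hγ t ht)).hasFDerivWithinAt
      (ContinuousLinearMap.ext_ring ?_))
    calc dirDeriv f (γ t) ((1 : ℝ) • V (γ t))
      _ = 0 := by rw [one_smul, hf' t ht]
      _ = ContinuousLinearMap.toSpanSingleton ℝ (0 : ℝ) 1 := by simp
  exact constant_of_has_deriv_right_zero (fun t ht ↦ (hderiv t ht).continuousWithinAt)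
    (fun t ht ↦ (hderiv t ⟨ht.1, ht.2.le⟩).mono_of_mem_nhdsWithin (Icc_mem_nhdsGE_of_mem ht))
    b ⟨hab, le_rfl⟩

end DirDeriv

variable {M : Type*} [TopologicalSpace M] [ChartedSpace (EuclideanSpace ℝ (Fin 4)) M]

theorem coord_add {x : M} (u w : TangentSpace (𝓡 4) x) (i : Fin 4) :
    coord (u + w) i = coord u i + coord w i :=
  rfl

theorem coord_smul {x : M} (c : ℝ) (u : TangentSpace (𝓡 4) x) (i : Fin 4) :
    coord (c • u) i = c * coord u i :=
  rfl

variable [IsManifold (𝓡 4) ∞ M]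

theorem christoffelMap_add_left (g : LorentzMetric M) (x : M) (u u' w : TangentSpace (𝓡 4) x) :
    g.christoffelMap x (u + u') w = g.christoffelMap x u w + g.christoffelMap x u' w := by
  simp only [LorentzMetric.christoffelMap, coord_add, mul_add, add_mul,
    Finset.sum_add_distrib, add_smul]

theorem christoffelMap_smul_left (g : LorentzMetric M) (x : M) (c : ℝ)
    (u w : TangentSpace (𝓡 4) x) :
    g.christoffelMap x (c • u) w = c • g.christoffelMap x u w := by
  simp only [LorentzMetric.christoffelMap, coord_smul, Finset.smul_sum,
    smul_smul, Finset.mul_sum]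
  refine Finset.sum_congr rfl fun k _ ↦ congrArg (· • _) ?_
  exact Finset.sum_congr rfl fun i _ ↦ Finset.sum_congr rfl fun j _ ↦ by ring

variable {H : Type*} [TopologicalSpace H] {F : H → M} {V W : ∀ q : H, TangentSpace (𝓡 4) (F q)}
  {p : H}

theorem form_eventuallyEq_chartForm (g : LorentzMetric M) (hF : ContinuousAt F p) :
    (fun q ↦ g.form (F q) (V q) (W q)) =ᶠ[nhds p] fun q ↦ g.chartForm (F p) (F q)
      (tangentTriv (F p) (⟨F q, V q⟩ : TangentBundle (𝓡 4) M)).2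
      (tangentTriv (F p) (⟨F q, W q⟩ : TangentBundle (𝓡 4) M)).2 := by
  filter_upwards [hF.preimage_mem_nhds ((tangentTriv (F p)).open_baseSet.mem_nhds
    (mem_baseSet_trivializationAt _ _ (F p)))] with q hq
  exact (LorentzMetric.chartForm_tangentTriv hq (V q) (W q)).symm

variable [ChartedSpace (EuclideanHalfSpace 3) H]

theorem covDeriv_add_right (g : LorentzMetric M) (X Y : TangentSpace (𝓡∂ 3) p) :
    covDeriv g F V p (X + Y) = covDeriv g F V p X + covDeriv g F V p Y := by
  simp only [covDeriv, componentDeriv, map_add, christoffelMap_add_left]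
  exact add_add_add_comm ..

theorem covDeriv_smul_right (g : LorentzMetric M) (c : ℝ) (X : TangentSpace (𝓡∂ 3) p) :
    covDeriv g F V p (c • X) = c • covDeriv g F V p X := by
  simp only [covDeriv, componentDeriv, map_smul, christoffelMap_smul_left]
  exact (smul_add ..).symm

variable (F V p) in
/-- Differentiability at `p` of a vector field `V` of `M` along a map `F : H → M`, expressed
through the corresponding map into the tangent bundle. -/
abbrev DifferentiableAlong : Prop :=
  MDifferentiableAt (𝓡∂ 3) (𝓡 4).tangent (fun q ↦ (⟨F q, V q⟩ : TangentBundle (𝓡 4) M)) p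

theorem hasMFDerivAt_form (g : LorentzMetric M) (hV : DifferentiableAlong F V p)
    (hW : DifferentiableAlong F W p) :
    ∃ f' : TangentSpace (𝓡∂ 3) p →L[ℝ] ℝ,
      HasMFDerivAt (𝓡∂ 3) 𝓘(ℝ, ℝ) (fun q ↦ g.form (F q) (V q) (W q)) p f' ∧
      ∀ X, f' X = g.form (F p) (V p) (componentDeriv F W p X) +
        (g.form (F p) (componentDeriv F V p X) (W p) +
          g.formDeriv (F p) (mfderiv (𝓡∂ 3) (𝓡 4) F p X) (V p) (W p)) := by
  obtain ⟨hF, hV'⟩ := (mdifferentiableAt_totalSpace _ _).1 hV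
  obtain ⟨-, hW'⟩ := (mdifferentiableAt_totalSpace _ _).1 hW
  have hG := (g.mdifferentiableAt_chartForm (F p)).hasMFDerivAt.comp p hF.hasMFDerivAt
  have h := hasMFDerivAt_clm_apply (hasMFDerivAt_clm_apply hG hV'.hasMFDerivAt) hW'.hasMFDerivAt
  refine ⟨_, h.congr_of_eventuallyEq (form_eventuallyEq_chartForm g hF.continuousAt), fun X ↦ ?_⟩
  rw [← g.chartForm_self]
  exact congrArg₂ (fun a b : EuclideanSpace ℝ (Fin 4) ↦
    g.chartForm (F p) (F p) a (componentDeriv F W p X) +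
      (g.chartForm (F p) (F p) (componentDeriv F V p X) b +
        g.formDeriv (F p) (mfderiv (𝓡∂ 3) (𝓡 4) F p X) a b))
    (tangentTriv_self (F p) (V p)) (tangentTriv_self (F p) (W p))

theorem dirDeriv_form (g : LorentzMetric M) (hV : DifferentiableAlong F V p)
    (hW : DifferentiableAlong F W p) (X : TangentSpace (𝓡∂ 3) p) :
    dirDeriv (fun q ↦ g.form (F q) (V q) (W q)) p X =
      g.form (F p) (covDeriv g F V p X) (W p) + g.form (F p) (V p) (covDeriv g F W p X) := by
  obtain ⟨f', hf', hf'X⟩ := hasMFDerivAt_form g hV hW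
  have hcompat := g.form_christoffelMap_add (F p) (mfderiv (𝓡∂ 3) (𝓡 4) F p X) (V p) (W p)
  calc dirDeriv (fun q ↦ g.form (F q) (V q) (W q)) p X
    _ = f' X := DFunLike.congr_fun hf'.mfderiv X
    _ = _ := by
      rw [hf'X, ← hcompat, covDeriv, covDeriv, map_add, map_add, add_apply]
      ring

end Connection

namespace NullHypersurface

variable {M : Type*} [TopologicalSpace M] [ChartedSpace (EuclideanSpace ℝ (Fin 4)) M]
  [IsManifold (𝓡 4) ∞ M] {g : LorentzMetric M}
  {H : Type*} [TopologicalSpace H] [ChartedSpace (EuclideanHalfSpace 3) H]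
  [IsManifold (𝓡∂ 3) ∞ H] (N : NullHypersurface g H)

section Algebra

variable {p : H}

theorem push_add (X Y : TangentSpace (𝓡∂ 3) p) : N.push (X + Y) = N.push X + N.push Y :=
  map_add _ X Y

theorem push_sub (X Y : TangentSpace (𝓡∂ 3) p) : N.push (X - Y) = N.push X - N.push Y :=
  map_sub _ X Y

theorem push_smul (c : ℝ) (X : TangentSpace (𝓡∂ 3) p) : N.push (c • X) = c • N.push X :=
  map_smul _ c X

theorem push_sum {ι : Type*} (t : Finset ι) (X : ι → TangentSpace (𝓡∂ 3) p) :
    N.push (∑ i ∈ t, X i) = ∑ i ∈ t, N.push (X i) :=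
  map_sum _ X t

theorem inner_comm (u w : TangentSpace (𝓡 4) (N.incl p)) : N.inner p u w = N.inner p w u :=
  g.symm _ u w

theorem inner_add_left (u u' w : TangentSpace (𝓡 4) (N.incl p)) :
    N.inner p (u + u') w = N.inner p u w + N.inner p u' w := by
  simp only [inner, map_add, add_apply]

theorem inner_smul_left (c : ℝ) (u w : TangentSpace (𝓡 4) (N.incl p)) :
    N.inner p (c • u) w = c * N.inner p u w := by
  simp only [inner, map_smul, smul_apply, smul_eq_mul]

theorem inner_sum_left {ι : Type*} (t : Finset ι) (u : ι → TangentSpace (𝓡 4) (N.incl p))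
    (w : TangentSpace (𝓡 4) (N.incl p)) :
    N.inner p (∑ i ∈ t, u i) w = ∑ i ∈ t, N.inner p (u i) w := by
  simp only [inner, map_sum, sum_apply]

theorem inner_add_right (u w w' : TangentSpace (𝓡 4) (N.incl p)) :
    N.inner p u (w + w') = N.inner p u w + N.inner p u w' :=
  map_add _ w w'

theorem inner_sub_right (u w w' : TangentSpace (𝓡 4) (N.incl p)) :
    N.inner p u (w - w') = N.inner p u w - N.inner p u w' :=
  map_sub _ w w'

theorem inner_smul_right (c : ℝ) (u w : TangentSpace (𝓡 4) (N.incl p)) :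
    N.inner p u (c • w) = c * N.inner p u w :=
  map_smul (g.form (N.incl p) u) c w

theorem inner_sum_right {ι : Type*} (t : Finset ι) (u : TangentSpace (𝓡 4) (N.incl p))
    (w : ι → TangentSpace (𝓡 4) (N.incl p)) :
    N.inner p u (∑ i ∈ t, w i) = ∑ i ∈ t, N.inner p u (w i) :=
  map_sum (g.form (N.incl p) u) w t

theorem inner_L_push (X : TangentSpace (𝓡∂ 3) p) : N.inner p (N.push (N.L p)) (N.push X) = 0 :=
  N.L_normal p X

theorem inner_push_L (X : TangentSpace (𝓡∂ 3) p) : N.inner p (N.push X) (N.push (N.L p)) = 0 :=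
  (N.inner_comm _ _).trans (N.inner_L_push X)

theorem inner_push_of_eq_add_smul_L {X Y Y' : TangentSpace (𝓡∂ 3) p} {c : ℝ}
    (hY : Y = Y' + c • N.L p) :
    N.inner p (N.push X) (N.push Y) = N.inner p (N.push X) (N.push Y') := by
  rw [hY, N.push_add, N.push_smul, N.inner_add_right, N.inner_smul_right, N.inner_push_L, mul_zero,
    add_zero]

theorem isLinearMap_inner_push (w : TangentSpace (𝓡 4) (N.incl p)) :
    IsLinearMap ℝ fun X : TangentSpace (𝓡∂ 3) p ↦ N.inner p w (N.push X) where
  map_add X Y := by rw [N.push_add, N.inner_add_right]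
  map_smul c X := by rw [N.push_smul, N.inner_smul_right, smul_eq_mul]

theorem Upsilon_L : N.Upsilon p (N.L p) = 1 :=
  N.L_s p

theorem isLinearMap_Upsilon : IsLinearMap ℝ (N.Upsilon p) :=
  ⟨dirDeriv_add_right N.s p, dirDeriv_smul_right N.s p⟩

theorem Upsilon_proj {e : Fin 2 → ∀ p : H, TangentSpace (𝓡∂ 3) p}
    (w : TangentSpace (𝓡 4) (N.incl p)) :
    N.Upsilon p (N.proj e p w) =
      ∑ A, N.Upsilon p (e A p) * N.inner p w (N.push (e A p)) := by
  refine (map_sum N.isLinearMap_Upsilon.mk'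
    (fun A ↦ N.inner p w (N.push (e A p)) • e A p) Finset.univ).trans ?_
  exact Finset.sum_congr rfl fun A _ ↦
    (N.isLinearMap_Upsilon.map_smul _ _).trans (mul_comm _ _)

theorem isLeafTangent_sub_Upsilon_smul_L (X : TangentSpace (𝓡∂ 3) p) :
    IsLeafTangent N.s (X - N.Upsilon p X • N.L p) := by
  change N.Upsilon p (X - N.Upsilon p X • N.L p) = 0
  rw [N.isLinearMap_Upsilon.map_sub, N.isLinearMap_Upsilon.map_smul, N.Upsilon_L, smul_eq_mul,
    mul_one, sub_self]

end Algebra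

section Coefficients

variable {V : ∀ q : H, TangentSpace (𝓡 4) (N.incl q)} {p : H}

theorem isLinearMap_chibar_left (Y : TangentSpace (𝓡∂ 3) p) :
    IsLinearMap ℝ fun X ↦ N.chibar V p X Y where
  map_add X X' := by simp only [chibar, D, covDeriv_add_right, inner_add_left]
  map_smul c X := by simp only [chibar, D, covDeriv_smul_right, inner_smul_left, smul_eq_mul]

theorem isLinearMap_chibar_right (X : TangentSpace (𝓡∂ 3) p) : IsLinearMap ℝ (N.chibar V p X) :=
  N.isLinearMap_inner_push _

theorem isLinearMap_chi_left (Y : TangentSpace (𝓡∂ 3) p) : IsLinearMap ℝ fun X ↦ N.chi p X Y :=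
  N.isLinearMap_chibar_left Y

theorem isLinearMap_chi_right (X : TangentSpace (𝓡∂ 3) p) : IsLinearMap ℝ (N.chi p X) :=
  N.isLinearMap_chibar_right X

theorem chibar_L_left (Y : TangentSpace (𝓡∂ 3) p) :
    N.chibar V p (N.L p) Y = 2 * N.etabar V p Y := by
  simp only [chibar, etabar]
  ring

theorem isLinearMap_etabar : IsLinearMap ℝ (N.etabar V p) where
  map_add X Y := by simp only [etabar, push_add, inner_add_right, mul_add]
  map_smul c X := by simp only [etabar, push_smul, inner_smul_right, smul_eq_mul, mul_left_comm]

theorem isLinearMap_zeta : IsLinearMap ℝ (N.zeta V p) where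
  map_add X Y := by simp only [zeta, D, covDeriv_add_right, inner_add_left, mul_add]
  map_smul c X := by
    simp only [zeta, D, covDeriv_smul_right, inner_smul_left, smul_eq_mul, mul_left_comm]

theorem D_L_L : N.D (fun q ↦ N.push (N.L q)) p (N.L p) = 0 :=
  N.L_geodesic p

theorem chi_L_left (Y : TangentSpace (𝓡∂ 3) p) : N.chi p (N.L p) Y = 0 := by
  rw [chi, D_L_L, inner, map_zero]
  rfl

theorem zeta_L : N.zeta V p (N.L p) = 0 := by
  rw [zeta, D_L_L, inner, map_zero]
  exact mul_zero _

end Coefficients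

section Compatibility

variable {V W : ∀ q : H, TangentSpace (𝓡 4) (N.incl q)} {p : H}

theorem differentiableAlong_push {Y : ∀ p : H, TangentSpace (𝓡∂ 3) p}
    (hY : ContMDiffAt (𝓡∂ 3) (𝓡∂ 3).tangent ∞ (fun q ↦ (⟨q, Y q⟩ : TangentBundle (𝓡∂ 3) H)) p) :
    DifferentiableAlong N.incl (fun q ↦ N.push (Y q)) p :=
  (((N.incl_smooth.contMDiff_tangentMap (m := ∞) (by simp)).contMDiffAt).comp p
    hY).mdifferentiableAt (by simp)

theorem differentiableAlong_push_L : DifferentiableAlong N.incl (fun q ↦ N.push (N.L q)) p :=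
  N.differentiableAlong_push (N.L_smooth p)

theorem mdifferentiableAt_inner (hV : DifferentiableAlong N.incl V p)
    (hW : DifferentiableAlong N.incl W p) :
    MDifferentiableAt (𝓡∂ 3) 𝓘(ℝ, ℝ) (fun q ↦ N.inner q (V q) (W q)) p :=
  let ⟨_, hf', _⟩ := hasMFDerivAt_form g hV hW
  hf'.mdifferentiableAt

theorem dirDeriv_inner (hV : DifferentiableAlong N.incl V p) (hW : DifferentiableAlong N.incl W p)
    (X : TangentSpace (𝓡∂ 3) p) :
    dirDeriv (fun q ↦ N.inner q (V q) (W q)) p X =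
      N.inner p (N.D V p X) (W p) + N.inner p (V p) (N.D W p X) :=
  dirDeriv_form g hV hW X

theorem inner_D_of_inner_eventuallyEq_const (hV : DifferentiableAlong N.incl V p)
    (hW : DifferentiableAlong N.incl W p) {c : ℝ}
    (hc : ∀ᶠ q in nhds p, N.inner q (V q) (W q) = c) (X : TangentSpace (𝓡∂ 3) p) :
    N.inner p (N.D V p X) (W p) = -N.inner p (V p) (N.D W p X) := by
  rw [eq_neg_iff_add_eq_zero, ← N.dirDeriv_inner hV hW, dirDeriv_congr hc, dirDeriv_const]

theorem chi_L_right (X : TangentSpace (𝓡∂ 3) p) : N.chi p X (N.L p) = 0 := by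
  have h := N.inner_D_of_inner_eventuallyEq_const N.differentiableAlong_push_L
    N.differentiableAlong_push_L (.of_forall fun q ↦ N.inner_push_L (N.L q)) X
  rw [N.inner_comm (N.push (N.L p))] at h
  exact self_eq_neg.1 h

end Compatibility

variable {N}

theorem eq_of_dirDeriv_L_eq_zero {U : Set H} (hUsat : N.IsGeneratorSaturated U) {f : H → ℝ} {c : ℝ}
    (hf : ∀ q ∈ U, MDifferentiableAt (𝓡∂ 3) 𝓘(ℝ, ℝ) f q)
    (hL : ∀ q ∈ U, dirDeriv f q (N.L q) = 0) (hS : ∀ q ∈ U, N.s q = 1 → f q = c)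
    {p : H} (hp : p ∈ U) : f p = c := by
  obtain ⟨γ, hγ₁, hγp, hγ⟩ := N.emanates p
  have hγU := hUsat γ (N.s p) (N.one_le_s p) hγ₁ hγ (hγp.symm ▸ hp)
  calc f p
    _ = f (γ (N.s p)) := by rw [hγp]
    _ = f (γ 1) := eq_of_dirDeriv_eq_zero (N.one_le_s p) hγ (fun t ht ↦ hf _ (hγU t ht))
      fun t ht ↦ hL _ (hγU t ht)
    _ = c := hS _ (hγU 1 ⟨le_rfl, N.one_le_s p⟩) hγ₁

namespace IsFermiNullFrame

variable {v : H → ℝ} {Lbar Lbar' : ∀ p : H, TangentSpace (𝓡 4) (N.incl p)}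
  {e e' : Fin 2 → ∀ p : H, TangentSpace (𝓡∂ 3) p} {U : Set H} {p : H}

section Decomposition

variable (h : N.IsFermiNullFrame v Lbar e U) (hp : p ∈ U)
include h hp

theorem inner_Lbar_e (A : Fin 2) : N.inner p (Lbar p) (N.push (e A p)) = 0 :=
  h.Lbar_orthogonal p hp _ (h.e_tangent A p hp)

theorem inner_L_Lbar : N.inner p (N.push (N.L p)) (Lbar p) = -2 :=
  (N.inner_comm _ _).trans (h.Lbar_L p hp)

theorem inner_combination_e (a : Fin 2 → ℝ) (b c : ℝ) (B : Fin 2) :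
    N.inner p (∑ A, a A • N.push (e A p) + b • N.push (N.L p) + c • Lbar p) (N.push (e B p)) =
      a B := by
  simp only [N.inner_add_left, N.inner_sum_left, N.inner_smul_left, h.e_orthonormal _ B p hp,
    N.inner_L_push, h.inner_Lbar_e hp, mul_ite, mul_one, mul_zero, Finset.sum_ite_eq',
    Finset.mem_univ, if_true, add_zero]

theorem inner_combination_L (a : Fin 2 → ℝ) (b c : ℝ) :
    N.inner p (∑ A, a A • N.push (e A p) + b • N.push (N.L p) + c • Lbar p) (N.push (N.L p)) =
      -2 * c := by
  simp only [N.inner_add_left, N.inner_sum_left, N.inner_smul_left, N.inner_push_L, h.Lbar_L p hp,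
    mul_zero, Finset.sum_const_zero, zero_add, mul_comm]

theorem inner_combination_Lbar (a : Fin 2 → ℝ) (b c : ℝ) :
    N.inner p (∑ A, a A • N.push (e A p) + b • N.push (N.L p) + c • Lbar p) (Lbar p) =
      -2 * b := by
  simp only [N.inner_add_left, N.inner_sum_left, N.inner_smul_left, h.inner_L_Lbar hp,
    N.inner_comm (N.push (e _ p)) (Lbar p), h.inner_Lbar_e hp, h.Lbar_null p hp,
    mul_zero, Finset.sum_const_zero, zero_add, add_zero, mul_comm]

/-- The components with respect to the frame define a linear map between 4-dimensional spaces,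
which is surjective by `inner_combination_e`, `inner_combination_L` and `inner_combination_Lbar`,
hence injective. -/
theorem ext_inner {w w' : TangentSpace (𝓡 4) (N.incl p)}
    (he : ∀ A, N.inner p w (N.push (e A p)) = N.inner p w' (N.push (e A p)))
    (hL : N.inner p w (N.push (N.L p)) = N.inner p w' (N.push (N.L p)))
    (hLbar : N.inner p w (Lbar p) = N.inner p w' (Lbar p)) : w = w' := by
  let components : TangentSpace (𝓡 4) (N.incl p) →ₗ[ℝ] (Fin 2 → ℝ) × ℝ × ℝ :=
    { toFun := fun w ↦ (fun A ↦ N.inner p w (N.push (e A p)),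
        N.inner p w (N.push (N.L p)), N.inner p w (Lbar p))
      map_add' := fun w w' ↦ by simp only [N.inner_add_left]; rfl
      map_smul' := fun c w ↦ by simp only [N.inner_smul_left]; rfl }
  have : FiniteDimensional ℝ (TangentSpace (𝓡 4) (N.incl p)) :=
    inferInstanceAs (FiniteDimensional ℝ (EuclideanSpace ℝ (Fin 4)))
  have hdim : Module.finrank ℝ (TangentSpace (𝓡 4) (N.incl p)) =
      Module.finrank ℝ ((Fin 2 → ℝ) × ℝ × ℝ) :=
    (finrank_euclideanSpace_fin (𝕜 := ℝ) (n := 4)).trans (by simp)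
  have hsurj : Function.Surjective components := fun ⟨a, b, c⟩ ↦
    ⟨_, Prod.ext (funext (h.inner_combination_e hp a (-c / 2) (-b / 2)))
      (Prod.ext ((h.inner_combination_L hp _ _ _).trans (by ring))
        ((h.inner_combination_Lbar hp _ _ _).trans (by ring)))⟩
  exact (LinearMap.injective_iff_surjective_of_finrank_eq_finrank hdim).2 hsurj
    (Prod.ext (funext he) (Prod.ext hL hLbar))

theorem eq_sum_inner_smul (w : TangentSpace (𝓡 4) (N.incl p)) :
    w = ∑ A, N.inner p w (N.push (e A p)) • N.push (e A p) +
      (-(1 / 2) * N.inner p w (Lbar p)) • N.push (N.L p) +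
      (-(1 / 2) * N.inner p w (N.push (N.L p))) • Lbar p := by
  refine h.ext_inner hp
    (fun A ↦ (h.inner_combination_e hp (fun A ↦ N.inner p w (N.push (e A p))) _ _ A).symm)
    (((h.inner_combination_L hp _ _ _).trans ?_).symm)
    (((h.inner_combination_Lbar hp _ _ _).trans ?_).symm) <;> ring

theorem tangent_eq_sum_inner_smul (X : TangentSpace (𝓡∂ 3) p) :
    X = ∑ A, N.inner p (N.push X) (N.push (e A p)) • e A p -
      (1 / 2 * N.inner p (Lbar p) (N.push X)) • N.L p := by
  refine N.incl_immersion p ((h.eq_sum_inner_smul hp (N.push X)).trans ?_)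
  change _ = N.push _
  rw [sub_eq_add_neg, ← neg_smul, N.push_add, N.push_sum, N.push_smul, N.inner_push_L,
    N.inner_comm (N.push X) (Lbar p), mul_zero, zero_smul, add_zero, neg_mul]
  simp only [N.push_smul]

theorem inner_push_proj (w : TangentSpace (𝓡 4) (N.incl p)) (B : Fin 2) :
    N.inner p (N.push (N.proj e p w)) (N.push (e B p)) = N.inner p w (N.push (e B p)) := by
  simp only [proj, N.push_sum, N.push_smul, N.inner_sum_left, N.inner_smul_left,
    h.e_orthonormal _ B p hp, mul_ite, mul_one, mul_zero, Finset.sum_ite_eq', Finset.mem_univ,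
    if_true]

theorem sum_inner_mul_apply {φ : TangentSpace (𝓡∂ 3) p → ℝ} (hφ : IsLinearMap ℝ φ)
    (Y : TangentSpace (𝓡∂ 3) p) :
    ∑ B, N.inner p (N.push Y) (N.push (e B p)) * φ (e B p) =
      φ Y + 1 / 2 * N.inner p (Lbar p) (N.push Y) * φ (N.L p) := by
  have hY := congrArg hφ.mk' (h.tangent_eq_sum_inner_smul hp Y)
  simp only [map_sub, map_sum, map_smul, IsLinearMap.mk'_apply, smul_eq_mul] at hY
  rw [hY]
  ring

end Decomposition

section Coefficients

variable (h : N.IsFermiNullFrame v Lbar e U) (hU : IsOpen U) (hp : p ∈ U)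
include h hU hp

theorem differentiableAlong_e (A : Fin 2) :
    DifferentiableAlong N.incl (fun q ↦ N.push (e A q)) p :=
  N.differentiableAlong_push ((h.e_smooth A).contMDiffAt (hU.mem_nhds hp))

theorem differentiableAlong_Lbar : DifferentiableAlong N.incl Lbar p :=
  (h.Lbar_smooth.contMDiffAt (hU.mem_nhds hp)).mdifferentiableAt (by simp)

theorem chibar_L_right (X : TangentSpace (𝓡∂ 3) p) :
    N.chibar Lbar p X (N.L p) = -2 * N.zeta Lbar p X := by
  have hD := N.inner_D_of_inner_eventuallyEq_const (h.differentiableAlong_Lbar hU hp)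
    N.differentiableAlong_push_L (Filter.eventually_of_mem (hU.mem_nhds hp) h.Lbar_L) X
  rw [chibar, zeta, hD, N.inner_comm (Lbar p)]
  ring

theorem etabar_L : N.etabar Lbar p (N.L p) = 0 := by
  have hL := h.chibar_L_right hU hp (N.L p)
  rw [N.chibar_L_left, N.zeta_L] at hL
  linarith

theorem inner_D_L_e (A : Fin 2) (X : TangentSpace (𝓡∂ 3) p) :
    N.inner p (N.D (fun q ↦ N.push (e A q)) p (N.L p)) (N.push X) = 0 := by
  set w := N.D (fun q ↦ N.push (e A q)) p (N.L p) with hw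
  have hwe (B : Fin 2) : N.inner p w (N.push (e B p)) = 0 := by
    rw [← h.inner_push_proj hp]
    exact (congrArg (fun Z ↦ N.inner p (N.push Z) _) (h.fermi A p hp)).trans
      (by rw [push, map_zero, inner, map_zero]; rfl)
  have hwL : N.inner p w (N.push (N.L p)) = 0 := by
    rw [hw, N.inner_D_of_inner_eventuallyEq_const (h.differentiableAlong_e hU hp A)
      N.differentiableAlong_push_L (.of_forall fun q ↦ N.inner_push_L (e A q)), N.D_L_L]
    simp [inner]
  have hsum := h.sum_inner_mul_apply hp (N.isLinearMap_inner_push w) X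
  simpa only [hwe, hwL, mul_zero, Finset.sum_const_zero, add_zero] using! hsum.symm

end Coefficients

section Comparison

theorem inner_geodesic_Lbar_push (h' : N.IsFermiNullFrame N.s Lbar' e' U) (hp : p ∈ U)
    (X : TangentSpace (𝓡∂ 3) p) : N.inner p (Lbar' p) (N.push X) = -2 * N.Upsilon p X := by
  have hX := h'.Lbar_orthogonal p hp _ (N.isLeafTangent_sub_Upsilon_smul_L X)
  rw [N.push_sub, N.push_smul, N.inner_sub_right, N.inner_smul_right, h'.Lbar_L p hp] at hX
  linarith

variable (h : N.IsFermiNullFrame v Lbar e U) (h' : N.IsFermiNullFrame N.s Lbar' e' U)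
include h h'

theorem inner_e_geodesic_e (hU : IsOpen U) (hUsat : N.IsGeneratorSaturated U)
    (hS : ∀ A, ∀ p ∈ U, N.s p = 1 → e' A p = e A p) (hp : p ∈ U) (A B : Fin 2) :
    N.inner p (N.push (e A p)) (N.push (e' B p)) = if A = B then 1 else 0 := by
  refine eq_of_dirDeriv_L_eq_zero (f := fun q ↦ N.inner q (N.push (e A q)) (N.push (e' B q)))
    hUsat (fun q hq ↦ N.mdifferentiableAt_inner (h.differentiableAlong_e hU hq A)
      (h'.differentiableAlong_e hU hq B)) (fun q hq ↦ ?_) (fun q hq hqS ↦ ?_) hp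
  · rw [N.dirDeriv_inner (h.differentiableAlong_e hU hq A) (h'.differentiableAlong_e hU hq B),
      h.inner_D_L_e hU hq, N.inner_comm (N.push (e A q)), h'.inner_D_L_e hU hq, add_zero]
  · rw [hS B q hq hqS, h.e_orthonormal A B q hq]

theorem e_eq_geodesic_e_add (hU : IsOpen U) (hUsat : N.IsGeneratorSaturated U)
    (hS : ∀ A, ∀ p ∈ U, N.s p = 1 → e' A p = e A p) (hp : p ∈ U) (A : Fin 2) :
    e A p = e' A p + N.Upsilon p (e A p) • N.L p := by
  refine (h'.tangent_eq_sum_inner_smul hp (e A p)).trans ?_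
  simp only [h.inner_e_geodesic_e h' hU hUsat hS hp, h'.inner_geodesic_Lbar_push hp, ite_smul,
    one_smul, zero_smul, Finset.sum_ite_eq, Finset.mem_univ, if_true]
  rw [sub_eq_add_neg, ← neg_smul]
  ring_nf

end Comparison

section Dagger

variable (h' : N.IsFermiNullFrame N.s Lbar' e' U) (hp : p ∈ U)
  (he : ∀ A, e A p = e' A p + N.Upsilon p (e A p) • N.L p)
include h' hp he

theorem dagger₁_eq {φ : ∀ p : H, TangentSpace (𝓡∂ 3) p → ℝ} (hφ : IsLinearMap ℝ (φ p))
    (X : TangentSpace (𝓡∂ 3) p) :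
    N.dagger₁ e e' φ p X = φ p X - N.Upsilon p X * φ p (N.L p) := by
  calc N.dagger₁ e e' φ p X
    _ = ∑ A, N.inner p (N.push X) (N.push (e' A p)) * φ p (e' A p) := by
      simp only [dagger₁, N.inner_push_of_eq_add_smul_L (he _)]
    _ = φ p X - N.Upsilon p X * φ p (N.L p) := by
      rw [h'.sum_inner_mul_apply hp hφ, h'.inner_geodesic_Lbar_push hp]
      ring

theorem dagger₂_eq {φ : ∀ p : H, TangentSpace (𝓡∂ 3) p → TangentSpace (𝓡∂ 3) p → ℝ}
    (hφ : ∀ Y, IsLinearMap ℝ fun X ↦ φ p X Y) (hφ' : ∀ X, IsLinearMap ℝ (φ p X))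
    (X Y : TangentSpace (𝓡∂ 3) p) :
    N.dagger₂ e e' φ p X Y = φ p X Y - N.Upsilon p X * φ p (N.L p) Y -
      N.Upsilon p Y * (φ p X (N.L p) - N.Upsilon p X * φ p (N.L p) (N.L p)) := by
  have hsum (Z : TangentSpace (𝓡∂ 3) p) :
      ∑ A, N.inner p (N.push X) (N.push (e' A p)) * φ p (e' A p) Z =
        φ p X Z - N.Upsilon p X * φ p (N.L p) Z := by
    rw [h'.sum_inner_mul_apply hp (hφ Z), h'.inner_geodesic_Lbar_push hp]
    ring
  calc N.dagger₂ e e' φ p X Y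
    _ = ∑ A, N.inner p (N.push X) (N.push (e' A p)) *
        ∑ B, N.inner p (N.push Y) (N.push (e' B p)) * φ p (e' A p) (e' B p) := by
      simp only [dagger₂, N.inner_push_of_eq_add_smul_L (he _), Finset.mul_sum, mul_assoc]
    _ = ∑ A, (N.inner p (N.push X) (N.push (e' A p)) * φ p (e' A p) Y -
        N.Upsilon p Y * (N.inner p (N.push X) (N.push (e' A p)) * φ p (e' A p) (N.L p))) := by
      refine Finset.sum_congr rfl fun A _ ↦ ?_
      rw [h'.sum_inner_mul_apply hp (hφ' _), h'.inner_geodesic_Lbar_push hp]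
      ring
    _ = _ := by rw [Finset.sum_sub_distrib, ← Finset.mul_sum, hsum, hsum]

theorem dagger₂_chi (X Y : TangentSpace (𝓡∂ 3) p) :
    N.dagger₂ e e' N.chi p X Y = N.chi p X Y := by
  rw [h'.dagger₂_eq hp he N.isLinearMap_chi_left N.isLinearMap_chi_right, N.chi_L_left,
    N.chi_L_left, N.chi_L_right]
  ring

theorem dagger₁_zeta (X : TangentSpace (𝓡∂ 3) p) :
    N.dagger₁ e e' (N.zeta Lbar') p X = N.zeta Lbar' p X := by
  rw [h'.dagger₁_eq hp he N.isLinearMap_zeta, N.zeta_L, mul_zero, sub_zero]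

theorem dagger₁_etabar (hU : IsOpen U) (X : TangentSpace (𝓡∂ 3) p) :
    N.dagger₁ e e' (N.etabar Lbar') p X = N.etabar Lbar' p X := by
  rw [h'.dagger₁_eq hp he N.isLinearMap_etabar, h'.etabar_L hU hp, mul_zero, sub_zero]

theorem dagger₂_chibar (hU : IsOpen U) (X Y : TangentSpace (𝓡∂ 3) p) :
    N.dagger₂ e e' (N.chibar Lbar') p X Y = N.chibar Lbar' p X Y -
      2 * N.Upsilon p X * N.etabar Lbar' p Y + 2 * N.zeta Lbar' p X * N.Upsilon p Y := by
  rw [h'.dagger₂_eq hp he N.isLinearMap_chibar_left N.isLinearMap_chibar_right,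
    h'.chibar_L_right hU hp, h'.chibar_L_right hU hp, N.zeta_L, N.chibar_L_left]
  ring

end Dagger

section Transformation

variable (h : N.IsFermiNullFrame v Lbar e U) (h' : N.IsFermiNullFrame N.s Lbar' e' U)
  (hp : p ∈ U) (he : ∀ A, e A p = e' A p + N.Upsilon p (e A p) • N.L p)
include h h' hp he

theorem Lbar_eq_geodesic_Lbar_add :
    Lbar p = Lbar' p + (2 : ℝ) • ∑ A, N.Upsilon p (e A p) • N.push (e A p) -
      N.UpsilonSq e p • N.push (N.L p) := by
  have he' (A : Fin 2) : N.push (e' A p) =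
      N.push (e A p) - N.Upsilon p (e A p) • N.push (N.L p) := by
    rw [eq_sub_iff_add_eq, ← N.push_smul, ← N.push_add, ← he]
  have hinner (A : Fin 2) : N.inner p (Lbar p) (N.push (e' A p)) = 2 * N.Upsilon p (e A p) := by
    rw [he', N.inner_sub_right, N.inner_smul_right, h.inner_Lbar_e hp, h.Lbar_L p hp]
    ring
  have hdecomp := h'.eq_sum_inner_smul hp (Lbar p)
  have hnull : N.inner p (Lbar p) (Lbar' p) = -2 * N.UpsilonSq e p := by
    have hLL := congrArg (N.inner p (Lbar p)) hdecomp
    simp only [N.inner_add_right, N.inner_sum_right, N.inner_smul_right, h.Lbar_null p hp,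
      h.Lbar_L p hp, hinner] at hLL
    simp only [UpsilonSq, Fin.sum_univ_two] at hLL ⊢
    linarith
  refine hdecomp.trans ?_
  simp only [hinner, hnull, h.Lbar_L p hp]
  simp only [he', UpsilonSq, Fin.sum_univ_two]
  module

theorem inner_Lbar_eq (w : TangentSpace (𝓡 4) (N.incl p)) :
    N.inner p w (Lbar p) = N.inner p w (Lbar' p) +
      2 * ∑ A, N.Upsilon p (e A p) * N.inner p w (N.push (e A p)) -
      N.UpsilonSq e p * N.inner p w (N.push (N.L p)) := by
  rw [h.Lbar_eq_geodesic_Lbar_add h' hp he, N.inner_sub_right, N.inner_add_right,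
    N.inner_smul_right, N.inner_smul_right, N.inner_sum_right]
  simp only [N.inner_smul_right]

theorem zeta_eq (X : TangentSpace (𝓡∂ 3) p) :
    N.zeta Lbar p X = N.zeta Lbar' p X + ∑ B, N.chi p X (e B p) * N.Upsilon p (e B p) := by
  have hL : N.inner p (N.D (fun q ↦ N.push (N.L q)) p X) (N.push (N.L p)) = 0 := N.chi_L_right X
  rw [zeta, h.inner_Lbar_eq h' hp he, hL, zeta]
  simp only [chi, mul_comm]
  ring

theorem chibar_e_eq (hU : IsOpen U) (X : TangentSpace (𝓡∂ 3) p) (B : Fin 2) :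
    N.chibar Lbar p X (e B p) = N.chibar Lbar' p X (e B p) +
      2 * (dirDeriv (fun q ↦ N.Upsilon q (e B q)) p X - N.Upsilon p (N.slashD e (e B) p X)) -
      N.UpsilonSq e p * N.chi p X (e B p) := by
  have hdB := h.differentiableAlong_e hU hp B
  set w := N.D (fun q ↦ N.push (e B q)) p X
  have hchibar : N.chibar Lbar p X (e B p) = -N.inner p w (Lbar p) := by
    rw [chibar, N.inner_D_of_inner_eventuallyEq_const (h.differentiableAlong_Lbar hU hp) hdB
      (Filter.eventually_of_mem (hU.mem_nhds hp) fun q hq ↦ h.inner_Lbar_e hq B), N.inner_comm]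
  have hchibar' : N.chibar Lbar' p X (e B p) =
      -2 * dirDeriv (fun q ↦ N.Upsilon q (e B q)) p X - N.inner p w (Lbar' p) := by
    have hdL := h'.differentiableAlong_Lbar hU hp
    have hUpsilon : (fun q ↦ N.Upsilon q (e B q)) =ᶠ[nhds p]
        fun q ↦ -(1 / 2) * N.inner q (Lbar' q) (N.push (e B q)) := by
      filter_upwards [hU.mem_nhds hp] with q hq
      rw [h'.inner_geodesic_Lbar_push hq]
      ring
    rw [dirDeriv_congr hUpsilon, dirDeriv_const_mul _ (N.mdifferentiableAt_inner hdL hdB),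
      N.dirDeriv_inner hdL hdB, N.inner_comm (Lbar' p), chibar]
    ring
  have hchi : N.chi p X (e B p) = -N.inner p w (N.push (N.L p)) := by
    rw [chi, N.inner_D_of_inner_eventuallyEq_const N.differentiableAlong_push_L hdB
      (.of_forall fun q ↦ N.inner_L_push (e B q)), N.inner_comm]
  have hslash : N.Upsilon p (N.slashD e (e B) p X) =
      ∑ A, N.Upsilon p (e A p) * N.inner p w (N.push (e A p)) :=
    N.Upsilon_proj w
  rw [hchibar, h.inner_Lbar_eq h' hp he, hchibar', hchi, hslash]
  ring

theorem chibar_eq (hU : IsOpen U) (X Y : TangentSpace (𝓡∂ 3) p) :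
    N.chibar Lbar p X Y = N.chibar Lbar' p X Y + 2 * N.slashDForm e N.Upsilon p X Y -
      N.UpsilonSq e p * N.chi p X Y +
      N.inner p (Lbar p) (N.push Y) * (N.zeta Lbar p X - N.zeta Lbar' p X) := by
  have hsum : ∑ B, N.inner p (N.push Y) (N.push (e B p)) * N.chibar Lbar p X (e B p) =
      ∑ B, N.inner p (N.push Y) (N.push (e B p)) * N.chibar Lbar' p X (e B p) +
        2 * N.slashDForm e N.Upsilon p X Y - N.UpsilonSq e p *
          ∑ B, N.inner p (N.push Y) (N.push (e B p)) * N.chi p X (e B p) := by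
    simp only [h.chibar_e_eq h' hp he hU, slashDForm, Finset.mul_sum, ← Finset.sum_add_distrib,
      ← Finset.sum_sub_distrib]
    exact Finset.sum_congr rfl fun B _ ↦ by ring
  rw [h.sum_inner_mul_apply hp (N.isLinearMap_chibar_right X),
    h.sum_inner_mul_apply hp (N.isLinearMap_chibar_right X),
    h.sum_inner_mul_apply hp (N.isLinearMap_chi_right X), h.chibar_L_right hU hp,
    h'.chibar_L_right hU hp, N.chi_L_right] at hsum
  linarith

theorem etabar_eq (hU : IsOpen U) (Y : TangentSpace (𝓡∂ 3) p) :
    N.etabar Lbar p Y = N.etabar Lbar' p Y + N.slashDForm e N.Upsilon p (N.L p) Y := by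
  have hL := h.chibar_eq h' hp he hU (N.L p) Y
  rw [N.chibar_L_left, N.chibar_L_left, N.chi_L_left, N.zeta_L, N.zeta_L] at hL
  linarith

end Transformation

end IsFermiNullFrame

end NullHypersurface

end NullGeometry

end

theorem proposition2p2_general {M : Type*} [TopologicalSpace M]
    [ChartedSpace (EuclideanSpace ℝ (Fin 4)) M] [IsManifold (𝓡 4) ∞ M]
    (g : NullGeometry.LorentzMetric M)
    {H : Type*} [TopologicalSpace H] [ChartedSpace (EuclideanHalfSpace 3) H]
    [IsManifold (𝓡∂ 3) ∞ H] (N : NullGeometry.NullHypersurface g H)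
    (v : H → ℝ)
    (U : Set H) (hU : IsOpen U) (hUsat : N.IsGeneratorSaturated U)
    (Lbar Lbar' : ∀ p : H, TangentSpace (𝓡 4) (N.incl p))
    (e e' : Fin 2 → ∀ p : H, TangentSpace (𝓡∂ 3) p)
    (hframe : N.IsFermiNullFrame v Lbar e U)
    (hframe' : N.IsFermiNullFrame N.s Lbar' e' U)
    (hS : ∀ A, ∀ p ∈ U, N.s p = 1 → e' A p = e A p)
    (p : H) (hp : p ∈ U) (X Y : TangentSpace (𝓡∂ 3) p)
    (hY : NullGeometry.IsLeafTangent v Y) :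
    N.chi p X Y = N.dagger₂ e e' N.chi p X Y ∧
    N.zeta Lbar p X = N.dagger₁ e e' (N.zeta Lbar') p X
      + ∑ B, N.dagger₂ e e' N.chi p X (e B p) * N.Upsilon p (e B p) ∧
    N.etabar Lbar p X = N.dagger₁ e e' (N.etabar Lbar') p X
      + N.slashDForm e N.Upsilon p (N.L p) X ∧
    N.chibar Lbar p X Y = N.dagger₂ e e' (N.chibar Lbar') p X Y
      + 2 * N.Upsilon p X * N.dagger₁ e e' (N.etabar Lbar') p Y
      - 2 * N.dagger₁ e e' (N.zeta Lbar') p X * N.Upsilon p Y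
      + 2 * N.slashDForm e N.Upsilon p X Y
      - N.UpsilonSq e p * N.dagger₂ e e' N.chi p X Y := by
  have he (A : Fin 2) := hframe.e_eq_geodesic_e_add hframe' hU hUsat hS hp A
  refine ⟨(hframe'.dagger₂_chi hp he X Y).symm, ?_, ?_, ?_⟩
  · simpa only [hframe'.dagger₁_zeta hp he, hframe'.dagger₂_chi hp he] using
      hframe.zeta_eq hframe' hp he X
  · rw [hframe'.dagger₁_etabar hp he hU, hframe.etabar_eq hframe' hp he hU]
  · rw [hframe.chibar_eq hframe' hp he hU, hframe.Lbar_orthogonal p hp Y hY,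
      hframe'.dagger₂_chibar hp he hU, hframe'.dagger₁_etabar hp he hU,
      hframe'.dagger₁_zeta hp he, hframe'.dagger₂_chi hp he]
    ring

theorem proposition2p2 {M : Type*} [TopologicalSpace M]
    [ChartedSpace (EuclideanSpace ℝ (Fin 4)) M] [IsManifold (𝓡 4) ∞ M]
    (g : NullGeometry.LorentzMetric M)
    {H : Type*} [TopologicalSpace H] [ChartedSpace (EuclideanHalfSpace 3) H]
    [IsManifold (𝓡∂ 3) ∞ H] (N : NullGeometry.NullHypersurface g H)
    (v : H → ℝ) (hv : N.IsFoliation v)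
    (U : Set H) (hU : IsOpen U) (hUsat : N.IsGeneratorSaturated U)
    (Lbar Lbar' : ∀ p : H, TangentSpace (𝓡 4) (N.incl p))
    (e e' : Fin 2 → ∀ p : H, TangentSpace (𝓡∂ 3) p)
    (hframe : N.IsFermiNullFrame v Lbar e U)
    (hframe' : N.IsFermiNullFrame N.s Lbar' e' U)
    (hS : ∀ A, ∀ p ∈ U, N.s p = 1 → e' A p = e A p)
    (p : H) (hp : p ∈ U) (X Y : TangentSpace (𝓡∂ 3) p)
    (hX : NullGeometry.IsLeafTangent v X) (hY : NullGeometry.IsLeafTangent v Y) :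
    N.chi p X Y = N.dagger₂ e e' N.chi p X Y ∧
    N.zeta Lbar p X = N.dagger₁ e e' (N.zeta Lbar') p X
      + ∑ B, N.dagger₂ e e' N.chi p X (e B p) * N.Upsilon p (e B p) ∧
    N.etabar Lbar p X = N.dagger₁ e e' (N.etabar Lbar') p X
      + N.slashDForm e N.Upsilon p (N.L p) X ∧
    N.chibar Lbar p X Y = N.dagger₂ e e' (N.chibar Lbar') p X Y
      + 2 * N.Upsilon p X * N.dagger₁ e e' (N.etabar Lbar') p Y
      - 2 * N.dagger₁ e e' (N.zeta Lbar') p X * N.Upsilon p Y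
      + 2 * N.slashDForm e N.Upsilon p X Y
      - N.UpsilonSq e p * N.dagger₂ e e' N.chi p X Y :=
  proposition2p2_general g N v U hU hUsat Lbar Lbar' e e' hframe hframe' hS p hp X Y hY
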